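/- Let $s,k,t,r$ be positive integers with $t\le s$. An $(s,k,m,t,r)$ locality functional array code is an encoding map $\mathcal E:\mathbb F_2^s\to(\mathbb F_2^t)^m$ of $s$ information bits $x=(x_1,\dots,x_s)$ into $m$ columns (buckets) of $t$ bits such that for every $v\in\mathbb F_2^s$ there are $k$ mutually disjoint sets of columns, each of size at most $r$, from each of which the bit $\langle v,x\rangle$ can be recovered (that is, it is a function of the contents of the columns in the set). Let $D(s,k,t,r)$ be the smallest $m$ for which such a code exists. Let $C_2(s,t,1)$ be the smallest size of a set of $t$-dimensional subspaces of $\mathbb F_2^s$ such that every $1$-dimensional subspace is contained in at least one of them. Let $A_2(s,t,k)$ be the smallest size of a multiset of subspaces of $\mathbb F_2^s$ of dimension at most $t$ such that every nonzero vector lies in exactly $k$ of them, counted with multiplicity. Let $B_2(s,t,\delta;\alpha)$ be the largest size of a set of $t$-dimensional subspaces of $\mathbb F_2^s$ any $\alpha$ of which span a subspace of dimension at least $\delta+t$. Let $\genfrac{[}{]}{0pt}{}{s}{t}_2=\prod_{i=0}^{t-1}\frac{2^{s-i}-1}{2^{t-i}-1}$. Then: 1. $D(s,1,t,1)=C_2(s,t,1)=\left\lceil\frac{2^s-1}{2^t-1}\right\rceil$.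 2. If $r\mid s$, then $D(s,1,t,r)\le r\left\lceil\frac{2^{s/r}-1}{2^t-1}\right\rceil$. 3. $D(s,k,t,1)\le A_2(s,t,k)$. 4. $D\big(s,\lfloor B_2(s,t,s-t;r)/r\rfloor,t,r\big)\le B_2(s,t,s-t;r)$, where $D(s,0,t,r)=0$. 5. If $t>1$, then $D\big(s,\genfrac{[}{]}{0pt}{}{s-1}{t-1}_2,t,1\big)\le\genfrac{[}{]}{0pt}{}{s}{t}_2$. 6. If $s=rt$, then $D\big(s,\big\lfloor\frac{2^s-2^t}{r2^t-r}\big\rfloor+1,t,r\big)\le\frac{2^s-1}{2^t-1}$. -/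

import Mathlib

namespace LocalityCode

open Module

/-! Locality functional array codes over the binary field -/

/-- `E` encodes `s` information bits into `m` columns (buckets) of `t` bits each. The set `S` of
columns is a recovering set for the linear combination `⟨v, x⟩` of the information bits: that bit
is a function `dec` of the contents of the columns in `S`. -/
def IsRecoveringSet {s m t : ℕ} (E : (Fin s → ZMod 2) → Fin m → Fin t → ZMod 2)
    (v : Fin s → ZMod 2) (S : Finset (Fin m)) : Prop :=
  ∃ dec : (S → Fin t → ZMod 2) → ZMod 2, ∀ x : Fin s → ZMod 2,
    dec (fun j => E x j) = v ⬝ᵥ x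

/-- `E` is the encoding map of an `(s, k, m, t, r)` locality functional array code: every linear
combination of the information bits has `k` mutually disjoint recovering sets, each consisting of
at most `r` columns. -/
def IsLocalityCode {s m t : ℕ} (k r : ℕ)
    (E : (Fin s → ZMod 2) → Fin m → Fin t → ZMod 2) : Prop :=
  ∀ v : Fin s → ZMod 2, ∃ S : Fin k → Finset (Fin m),
    (∀ i j, i ≠ j → Disjoint (S i) (S j)) ∧
    ∀ i, (S i).card ≤ r ∧ IsRecoveringSet E v (S i)

/-- `D(s, k, t, r)`: the smallest number `m` of buckets of an `(s, k, m, t, r)` locality functional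
array code (`⊤` if there were none, so that an upper bound asserts that a code exists). -/
noncomputable def D (s k t r : ℕ) : ℕ∞ :=
  ⨅ (m : ℕ) (_ : ∃ E : (Fin s → ZMod 2) → Fin m → Fin t → ZMod 2, IsLocalityCode k r E), (m : ℕ∞)

/-! Subspace structures in `F ^ s`, where `F` is a finite field -/

/-- The Grassmannian: the `t`-dimensional subspaces of `F ^ s`. -/
def Gr (F : Type*) [Field F] (s t : ℕ) : Set (Submodule F (Fin s → F)) :=
  {W | finrank F W = t}

/-- A covering design: a set of `t`-subspaces such that every `a`-subspace is contained in at
least one of them. -/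
def IsCoveringDesign (F : Type*) [Field F] (s t a : ℕ)
    (C : Finset (Submodule F (Fin s → F))) : Prop :=
  (∀ W ∈ C, W ∈ Gr F s t) ∧ ∀ U ∈ Gr F s a, ∃ W ∈ C, U ≤ W

/-- The covering number `C_q(s, t, a)`, for `q = |F|`: the minimum size of a covering design. -/
noncomputable def coveringNumber (F : Type*) [Field F] (s t a : ℕ) : ℕ∞ :=
  ⨅ (C : Finset (Submodule F (Fin s → F))) (_ : IsCoveringDesign F s t a C), (C.card : ℕ∞)

open Classical in
/-- A `lam`-fold partition of `F ^ s`: a multiset of subspaces such that every nonzero vector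
lies in exactly `lam` of them, counted with multiplicity. -/
def IsFoldPartition (F : Type*) [Field F] (s lam : ℕ)
    (P : Multiset (Submodule F (Fin s → F))) : Prop :=
  ∀ v : Fin s → F, v ≠ 0 → P.countP (fun W => v ∈ W) = lam

/-- `A_q(s, t, lam)`, for `q = |F|`: the minimum size of a `lam`-fold partition of `F ^ s` without
a subspace of dimension larger than `t`. -/
noncomputable def foldPartitionNumber (F : Type*) [Field F] (s t lam : ℕ) : ℕ∞ :=
  ⨅ (P : Multiset (Submodule F (Fin s → F)))
    (_ : IsFoldPartition F s lam P ∧ ∀ W ∈ P, finrank F W ≤ t), (P.card : ℕ∞)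

/-- An `α`-`(s, t, δ)` covering Grassmannian code: a set of `t`-subspaces of `F ^ s` such that any
`α` of them span a subspace of dimension at least `δ + t`. -/
def IsCoveringGrassmannianCode (F : Type*) [Field F] (s t δ α : ℕ)
    (C : Finset (Submodule F (Fin s → F))) : Prop :=
  (∀ W ∈ C, W ∈ Gr F s t) ∧
  ∀ T ⊆ C, T.card = α → δ + t ≤ finrank F ↥(T.sup id)

/-- `B_q(s, t, δ; α)`, for `q = |F|`: the maximum size of an `α`-`(s, t, δ)` covering Grassmannian
code. -/
noncomputable def grassmannianCodeNumber (F : Type*) [Field F] [Finite F] (s t δ α : ℕ) : ℕ :=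
  sSup {n | ∃ C : Finset (Submodule F (Fin s → F)),
    IsCoveringGrassmannianCode F s t δ α C ∧ C.card = n}

/-- The supremum defining `B_q(s, t, δ; α)` is a maximum. -/
theorem exists_card_eq_grassmannianCodeNumber (F : Type*) [Field F] [Finite F] (s t δ α : ℕ)
    (h : 0 < α) :
    ∃ C : Finset (Submodule F (Fin s → F)),
      IsCoveringGrassmannianCode F s t δ α C ∧ C.card = grassmannianCodeNumber F s t δ α := by
  have : Finite (Submodule F (Fin s → F)) :=
    Finite.of_injective (fun W => (W : Set (Fin s → F))) SetLike.coe_injective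
  have := Fintype.ofFinite (Submodule F (Fin s → F))
  refine Nat.sSup_mem (s := {n | ∃ C : Finset (Submodule F (Fin s → F)),
    IsCoveringGrassmannianCode F s t δ α C ∧ C.card = n}) ⟨0, ∅, ⟨by simp, ?_⟩, rfl⟩
    ⟨Fintype.card (Submodule F (Fin s → F)), ?_⟩
  · intro T hT hc
    rw [Finset.subset_empty.mp hT, Finset.card_empty] at hc
    omega
  · rintro n ⟨C, -, rfl⟩
    exact Finset.card_le_univ C

/-- The `q`-ary Gaussian coefficient, for `t ≤ s` and `q ≥ 2`,
`(q^s - 1)(q^(s-1) - 1)⋯(q^(s-t+1) - 1) / ((q^t - 1)(q^(t-1) - 1)⋯(q - 1))`;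
the division of natural numbers is exact. -/
def gaussianCoeff (q s t : ℕ) : ℕ :=
  (∏ i ∈ Finset.range t, (q ^ (s - i) - 1)) / ∏ i ∈ Finset.range t, (q ^ (t - i) - 1)

end LocalityCode

namespace LocalityCode

open Module

/-! Upper bounds come from linear codes. Given subspaces `W i` of dimension at most `t`, bucket `i`
stores a spanning family of `W i`; then `v` is recoverable from every set of buckets whose subspaces
together span a space containing `v` (`D_le_of_submodules`). Each bound is thus a geometric choice
of subspaces: a covering, blockwise coverings, a fold partition, a covering Grassmannian code cut
into groups of `r`, all `t`-subspaces, or a Desarguesian spread.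

Item 1 closes a cycle of inequalities. The sphere-covering count bounds `coveringNumber` below. Any
code, linear or not, yields a covering, because the combinations recoverable from one bucket form a
subspace of dimension at most `t` (`finrank_recoverable_singleton_le`). Finally `exists_covering`
attains the counting bound.

For item 6, the spread consists of the points of the projective space of `K^r` with `|K| = 2^t`. A
nonzero `v` lies on its own point, and on each line through that point the remaining points pair off
as `u + a • v`, `u + (a + 1) • v`, with difference `v`. -/

theorem exists_surjective_of_finrank_le {F A B : Type*} [Field F] [AddCommGroup A] [Module F A]
    [AddCommGroup B] [Module F B] [Module.Finite F A] [Module.Finite F B]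
    (h : finrank F B ≤ finrank F A) : ∃ f : A →ₗ[F] B, Function.Surjective f := by
  obtain ⟨g, hg⟩ := finrank_le_iff_exists_linearMap.mp h
  obtain ⟨f, hf⟩ := g.exists_leftInverse_of_injective (LinearMap.ker_eq_bot.mpr hg)
  exact ⟨f, fun b => ⟨g b, LinearMap.congr_fun hf b⟩⟩

/-! ### Codes and families of subspaces -/

/-- The linear combinations of the information bits recovered by a set of columns. -/
def recoverable {s m t : ℕ} (E : (Fin s → ZMod 2) → Fin m → Fin t → ZMod 2)
    (S : Finset (Fin m)) : Submodule (ZMod 2) (Fin s → ZMod 2) where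
  carrier := {v | IsRecoveringSet E v S}
  add_mem' := by
    rintro v w ⟨d, hd⟩ ⟨e, he⟩
    exact ⟨fun y => d y + e y, fun x =>
      (congrArg₂ (· + ·) (hd x) (he x)).trans (add_dotProduct v w x).symm⟩
  zero_mem' := ⟨fun _ => 0, fun x => (zero_dotProduct x).symm⟩
  smul_mem' := by
    rintro c v ⟨d, hd⟩
    exact ⟨fun y => c • d y, fun x =>
      (congrArg (c • ·) (hd x)).trans (smul_dotProduct c v x).symm⟩

theorem mem_recoverable {s m t : ℕ} {E : (Fin s → ZMod 2) → Fin m → Fin t → ZMod 2}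
    {S : Finset (Fin m)} {v : Fin s → ZMod 2} :
    v ∈ recoverable E S ↔ IsRecoveringSet E v S := Iff.rfl

theorem recoverable_empty {s m t : ℕ} (E : (Fin s → ZMod 2) → Fin m → Fin t → ZMod 2) :
    recoverable E ∅ = ⊥ := by
  rw [eq_bot_iff]
  rintro v ⟨d, hd⟩
  rw [Submodule.mem_bot]
  refine dotProduct_eq_zero_iff.mp fun x => ?_
  have h0 := hd 0
  rw [dotProduct_zero] at h0
  rw [← hd x, ← h0]
  congr 1
  funext j
  exact absurd j.2 (Finset.notMem_empty _)

/-- Every functional on the recoverable space is the pairing with some input `x`, and the content of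
the bucket at `x` determines that functional. So the dual injects into the `2 ^ t` possible
contents; linearity of `E` plays no role. -/
theorem finrank_recoverable_singleton_le {s m t : ℕ}
    (E : (Fin s → ZMod 2) → Fin m → Fin t → ZMod 2) (j : Fin m) :
    finrank (ZMod 2) (recoverable E {j}) ≤ t := by
  set V := recoverable E {j}
  have key : ∀ φ : Dual (ZMod 2) V, ∃ x : Fin s → ZMod 2, ∀ v : V, φ v = (v : _) ⬝ᵥ x := by
    intro φ
    obtain ⟨ψ, hψ⟩ := LinearMap.exists_extend φ
    refine ⟨(dotProductEquiv (ZMod 2) (Fin s)).symm ψ, fun v => ?_⟩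
    rw [dotProduct_comm, ← dotProductEquiv_apply_apply, LinearEquiv.apply_symm_apply, ← hψ]
    rfl
  choose x hx using key
  have hinj : Function.Injective fun φ => E (x φ) j := by
    intro φ ψ h
    ext v
    obtain ⟨d, hd⟩ := mem_recoverable.mp v.2
    rw [hx, hx, ← hd, ← hd]
    congr 1
    funext i
    rw [Finset.mem_singleton.mp i.2]
    exact h
  have hle := Nat.card_le_card_of_injective _ hinj
  rw [Module.natCard_eq_pow_finrank (K := ZMod 2), Subspace.dual_finrank_eq, Nat.card_fun] at hle
  simp only [Nat.card_eq_fintype_card, ZMod.card, Fintype.card_fin] at hle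
  exact (Nat.pow_le_pow_iff_right (by norm_num)).mp hle

theorem D_le {s k m t r : ℕ} {E : (Fin s → ZMod 2) → Fin m → Fin t → ZMod 2}
    (h : IsLocalityCode k r E) : D s k t r ≤ m :=
  iInf₂_le m ⟨E, h⟩

/-- The code storing in each bucket the linear combinations of the information bits that
lie in a given subspace. -/
theorem D_le_of_submodules {s k t r : ℕ} {V ι : Type*} [AddCommGroup V] [Module (ZMod 2) V]
    [Module.Finite (ZMod 2) V] (hV : finrank (ZMod 2) V = s) [Fintype ι]
    (W : ι → Submodule (ZMod 2) V) (hW : ∀ i, finrank (ZMod 2) (W i) ≤ t)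
    (h : ∀ v : V, v ≠ 0 → ∃ S : Fin k → Finset ι, Pairwise (Function.onFun Disjoint S) ∧
      ∀ i, (S i).card ≤ r ∧ v ∈ (S i).sup W) :
    D s k t r ≤ Fintype.card ι := by
  let e : V ≃ₗ[ZMod 2] (Fin s → ZMod 2) := LinearEquiv.ofFinrankEq _ _ (by simpa using hV)
  let ε := Fintype.equivFin ι
  have hg : ∀ a, ∃ g : (Fin t → ZMod 2) →ₗ[ZMod 2] V, LinearMap.range g = W a := by
    intro a
    obtain ⟨g, hg⟩ := exists_surjective_of_finrank_le (F := ZMod 2) (A := Fin t → ZMod 2)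
      (B := W a) (by simpa using hW a)
    refine ⟨(W a).subtype ∘ₗ g, ?_⟩
    rw [LinearMap.range_comp, LinearMap.range_eq_top.mpr hg, Submodule.map_top,
      Submodule.range_subtype]
  choose g hg using hg
  let E : (Fin s → ZMod 2) → Fin (Fintype.card ι) → Fin t → ZMod 2 :=
    fun x j i => e (g (ε.symm j) (Pi.single i 1)) ⬝ᵥ x
  have hsub : ∀ (S : Finset ι), S.sup W ≤
      (recoverable E (S.map ε.toEmbedding)).comap e.toLinearMap := by
    intro S
    refine Finset.sup_le fun a ha => ?_
    rw [← hg a]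
    rintro _ ⟨c, rfl⟩
    refine ⟨fun y => ∑ i, c i * y ⟨ε a, Finset.mem_map_of_mem _ ha⟩ i, fun x => ?_⟩
    conv_rhs => rw [← Finset.univ_sum_single c]
    simp only [E, Equiv.symm_apply_apply, map_sum, LinearEquiv.coe_coe, sum_dotProduct]
    refine Finset.sum_congr rfl fun i _ => ?_
    have : (Pi.single i (c i) : Fin t → ZMod 2) = c i • Pi.single i 1 := by
      rw [← Pi.single_smul, smul_eq_mul, mul_one]
    rw [this, map_smul, map_smul, smul_dotProduct, smul_eq_mul]
  refine D_le (E := E) fun v => ?_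
  -- The zero combination needs no columns: empty sets are pairwise disjoint even when repeated.
  by_cases hv : v = 0
  · refine ⟨fun _ => ∅, fun _ _ _ => Finset.disjoint_empty_left _, fun i => ⟨by simp, ?_⟩⟩
    rw [hv]
    exact (recoverable E ∅).zero_mem
  · obtain ⟨S, hS, hSv⟩ := h (e.symm v) (by simpa using hv)
    refine ⟨fun i => (S i).map ε.toEmbedding, fun i j hij => ?_, fun i => ⟨?_, ?_⟩⟩
    · exact (Finset.disjoint_map _).mpr (hS hij)
    · rw [Finset.card_map]
      exact (hSv i).1
    · have := hsub _ (hSv i).2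
      simpa [mem_recoverable] using this

/-- Version of `D_le_of_submodules` where the recovering sets are indexed by a finite type. -/
theorem D_le_of_submodules_of_card_le {s k t r : ℕ} {V ι : Type*} [AddCommGroup V]
    [Module (ZMod 2) V]
    [Module.Finite (ZMod 2) V] (hV : finrank (ZMod 2) V = s) [Fintype ι]
    (W : ι → Submodule (ZMod 2) V) (hW : ∀ i, finrank (ZMod 2) (W i) ≤ t)
    (h : ∀ v : V, v ≠ 0 → ∃ (κ : Type) (_ : Finite κ) (S : κ → Finset ι),
      k ≤ Nat.card κ ∧ Pairwise (Function.onFun Disjoint S) ∧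
      ∀ i, (S i).card ≤ r ∧ v ∈ (S i).sup W) :
    D s k t r ≤ Fintype.card ι := by
  refine D_le_of_submodules hV W hW fun v hv => ?_
  obtain ⟨κ, _, S, hk, hS, hSv⟩ := h v hv
  let f : Fin k → κ := fun i => (Finite.equivFin κ).symm (Fin.castLE hk i)
  have hf : Function.Injective f :=
    (Finite.equivFin κ).symm.injective.comp (Fin.castLE_injective hk)
  exact ⟨S ∘ f, fun i j hij => hS (hf.ne hij), fun i => hSv (f i)⟩

/-! ### Coverings by subspaces -/

theorem exists_le_finrank_eq {F V : Type*} [Field F] [AddCommGroup V] [Module F V]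
    [Module.Finite F V] (W : Submodule F V) {t : ℕ} (hW : finrank F W ≤ t)
    (ht : t ≤ finrank F V) : ∃ U : Submodule F V, W ≤ U ∧ finrank F U = t := by
  obtain ⟨C, hC⟩ := W.exists_isCompl
  have hsum := Submodule.finrank_add_eq_of_isCompl hC
  obtain ⟨f, hf⟩ := finrank_le_iff_exists_linearMap.mp
    (show finrank F (Fin (t - finrank F W) → F) ≤ finrank F C by
      rw [finrank_fin_fun]; omega)
  have hf' : finrank F (LinearMap.range (C.subtype ∘ₗ f)) = t - finrank F W := by
    rw [LinearMap.finrank_range_of_inj (by simpa using hf), finrank_fin_fun]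
  have hle : LinearMap.range (C.subtype ∘ₗ f) ≤ C := by
    rintro _ ⟨x, rfl⟩
    exact (f x).2
  refine ⟨W ⊔ LinearMap.range (C.subtype ∘ₗ f), le_sup_left, ?_⟩
  have h := Submodule.finrank_sup_add_finrank_inf_eq W (LinearMap.range (C.subtype ∘ₗ f))
  rw [(hC.disjoint.mono_right hle).eq_bot, finrank_bot, hf'] at h
  omega

/-- The bound `⌈(2^d - 1) / (2^t - 1)⌉` on the number of subspaces in a covering. -/
def ceilRatio (t d : ℕ) : ℕ := ⌈((2 : ℚ) ^ d - 1) / ((2 : ℚ) ^ t - 1)⌉₊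

theorem two_pow_sub_one_pos {t : ℕ} (ht : 0 < t) : 0 < (2 : ℚ) ^ t - 1 :=
  sub_pos.mpr (one_lt_pow₀ (by norm_num) ht.ne')

theorem ceilRatio_pos {t d : ℕ} (ht : 0 < t) (hd : 0 < d) : 0 < ceilRatio t d :=
  Nat.ceil_pos.mpr (div_pos (two_pow_sub_one_pos hd) (two_pow_sub_one_pos ht))

theorem ceilRatio_self {t : ℕ} (ht : 0 < t) : ceilRatio t t = 1 := by
  rw [ceilRatio, div_self (two_pow_sub_one_pos ht).ne', Nat.ceil_one]

theorem ceilRatio_eq_add {t d : ℕ} (ht : 0 < t) (htd : t ≤ d) :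
    ceilRatio t d = 2 ^ (d - t) + ceilRatio t (d - t) := by
  obtain ⟨e, rfl⟩ := Nat.exists_eq_add_of_le' htd
  have h := two_pow_sub_one_pos ht
  have he : ((2 : ℚ) ^ (e + t) - 1) / (2 ^ t - 1) =
      (2 ^ e - 1) / (2 ^ t - 1) + ((2 ^ e : ℕ) : ℚ) := by
    push_cast
    rw [div_add' _ _ _ h.ne', pow_add]
    ring
  have h0 : 0 ≤ ((2 : ℚ) ^ e - 1) / (2 ^ t - 1) :=
    div_nonneg (sub_nonneg.mpr (one_le_pow₀ (by norm_num))) h.le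
  rw [ceilRatio, he, Nat.ceil_add_natCast h0, Nat.add_sub_cancel, ceilRatio, add_comm]

/-- `V` is the union of few subspaces of dimension at most `t`: graphs of scalar multiples of
a linear map into an extension field, together with a covering of a smaller space. -/
theorem exists_covering {t : ℕ} (ht : 0 < t) (d : ℕ) (hd : 0 < d) {V : Type} [AddCommGroup V]
    [Module (ZMod 2) V] [Module.Finite (ZMod 2) V] (hV : finrank (ZMod 2) V = d) :
    ∃ C : Finset (Submodule (ZMod 2) V), C.card ≤ ceilRatio t d ∧
      (∀ W ∈ C, finrank (ZMod 2) W ≤ t) ∧ ∀ v : V, ∃ W ∈ C, v ∈ W := by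
  classical
  induction d using Nat.strong_induction_on generalizing V with
  | _ d ih =>
    by_cases hdt : d ≤ t
    · refine ⟨{⊤}, by rw [Finset.card_singleton]; exact ceilRatio_pos ht hd, ?_, fun v => ⟨⊤, by simp⟩⟩
      intro W hW
      rw [Finset.mem_singleton.mp hW, finrank_top, hV]
      exact hdt
    push Not at hdt
    let K := GaloisField 2 (d - t)
    let A := Fin t → ZMod 2
    have hK : finrank (ZMod 2) K = d - t := GaloisField.finrank 2 (by omega)
    have hKc : Nat.card K = 2 ^ (d - t) := GaloisField.card 2 _ (by omega)
    have : Finite K := Nat.finite_of_card_ne_zero (by rw [hKc]; positivity)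
    have := Fintype.ofFinite K
    have hA : finrank (ZMod 2) A = t := by simp [A]
    -- The graphs of `a • f` miss only vectors of `K × ker f`. With `f` of maximal rank this
    -- remainder has dimension `max (d - t) t`; in the second case one subspace suffices.
    have hf : ∃ f : A →ₗ[ZMod 2] K, ∃ C : Finset (Submodule (ZMod 2) (K × LinearMap.ker f)),
        C.card ≤ ceilRatio t (d - t) ∧ (∀ W ∈ C, finrank (ZMod 2) W ≤ t) ∧
        ∀ v, ∃ W ∈ C, v ∈ W := by
      rcases le_total t (d - t) with h | h
      · obtain ⟨f, hf⟩ := finrank_le_iff_exists_linearMap.mp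
          (show finrank (ZMod 2) A ≤ finrank (ZMod 2) K by omega)
        refine ⟨f, ih (d - t) (by omega) (by omega) ?_⟩
        rw [finrank_prod, LinearMap.ker_eq_bot.mpr hf, finrank_bot, hK,
          add_zero]
      · obtain ⟨f, hf⟩ := exists_surjective_of_finrank_le
          (show finrank (ZMod 2) K ≤ finrank (ZMod 2) A by omega)
        have hker := f.finrank_range_add_finrank_ker
        rw [LinearMap.range_eq_top.mpr hf, finrank_top, hK, hA] at hker
        obtain ⟨C, hC, hC'⟩ := ih t hdt ht 
          (V := K × LinearMap.ker f) (by rw [finrank_prod, hK, hker])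
        refine ⟨f, C, hC.trans ?_, hC'⟩
        rw [ceilRatio_self ht]
        exact ceilRatio_pos ht (by omega)
    obtain ⟨f, C, hCcard, hCdim, hC⟩ := hf
    let e : (K × A) ≃ₗ[ZMod 2] V := LinearEquiv.ofFinrankEq _ _ (by
      rw [finrank_prod, hK, hA, hV]; omega)
    let γ : K → A →ₗ[ZMod 2] K × A :=
      fun a => (LinearMap.mulLeft (ZMod 2) a ∘ₗ f).prod LinearMap.id
    refine ⟨(Finset.univ.image fun a => LinearMap.range (e.toLinearMap ∘ₗ γ a)) ∪
      C.image fun W => W.map (e.toLinearMap ∘ₗ LinearMap.id.prodMap (LinearMap.ker f).subtype), ?_, ?_, ?_⟩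
    · rw [ceilRatio_eq_add ht hdt.le]
      refine (Finset.card_union_le _ _).trans (add_le_add ?_ (Finset.card_image_le.trans hCcard))
      refine Finset.card_image_le.trans ?_
      rw [Finset.card_univ, ← Nat.card_eq_fintype_card, hKc]
    · intro W hW
      rw [Finset.mem_union, Finset.mem_image, Finset.mem_image] at hW
      obtain ⟨a, -, rfl⟩ | ⟨U, hU, rfl⟩ := hW
      · exact (LinearMap.finrank_range_le _).trans hA.le
      · exact (Submodule.finrank_map_le _ _).trans (hCdim U hU)
    · intro v
      obtain ⟨⟨y, u⟩, rfl⟩ := e.surjective v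
      by_cases hu : f u = 0
      · obtain ⟨W, hW, hvW⟩ := hC (y, ⟨u, hu⟩)
        exact ⟨_, Finset.mem_union_right _ (Finset.mem_image_of_mem _ hW),
          Submodule.mem_map_of_mem hvW⟩
      -- If `f u ≠ 0`, then `(y, u)` lies on the graph with slope `a = y / f u`.
      · refine ⟨_, Finset.mem_union_left _ (Finset.mem_image_of_mem _
          (Finset.mem_univ (y / f u))), u, ?_⟩
        simp [γ, div_mul_cancel₀ _ hu]

theorem D_le_ceilRatio {s t : ℕ} (hs : 0 < s) (ht : 0 < t) :
    D s 1 t 1 ≤ (ceilRatio t s : ℕ∞) := by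
  obtain ⟨C, hC, hCdim, hCv⟩ := exists_covering ht s hs (V := Fin s → ZMod 2) (by simp)
  refine (D_le_of_submodules (V := Fin s → ZMod 2) (by simp) (fun W : C => (W : Submodule _ _))
    (fun W => hCdim W W.2) fun v _ => ?_).trans (by simpa using hC)
  obtain ⟨W, hW, hvW⟩ := hCv v
  exact ⟨fun _ => {⟨W, hW⟩}, fun i j hij => absurd (Subsingleton.elim i j) hij,
    fun _ => ⟨by simp, by simpa using hvW⟩⟩

theorem coveringNumber_le_D {s t : ℕ} (hts : t ≤ s) :
    coveringNumber (ZMod 2) s t 1 ≤ D s 1 t 1 := by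
  classical
  refine le_iInf₂ fun m ⟨E, hE⟩ => ?_
  choose U hVU hU using fun j => exists_le_finrank_eq (recoverable E {j})
    (finrank_recoverable_singleton_le E j) (by simpa using hts)
  have hcov : IsCoveringDesign (ZMod 2) s t 1 (Finset.univ.image U) := by
    refine ⟨?_, ?_⟩
    · intro W hW
      obtain ⟨j, -, rfl⟩ := Finset.mem_image.mp hW
      exact hU j
    · intro L hL
      obtain ⟨v, hv, hvL⟩ := finrank_eq_one_iff'.mp (show finrank (ZMod 2) L = 1 from hL)
      obtain ⟨S, -, hS⟩ := hE v
      obtain ⟨hcard, hrec⟩ := hS 0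
      have hmem := mem_recoverable.mpr hrec
      rcases Nat.le_one_iff_eq_zero_or_eq_one.mp hcard with h | h
      · rw [Finset.card_eq_zero.mp h, recoverable_empty, Submodule.mem_bot] at hmem
        exact absurd (Subtype.ext hmem) hv
      · obtain ⟨j, hj⟩ := Finset.card_eq_one.mp h
        refine ⟨U j, Finset.mem_image_of_mem _ (Finset.mem_univ j), fun w hw => ?_⟩
        obtain ⟨c, hc⟩ := hvL ⟨w, hw⟩
        rw [show w = c • (v : Fin s → ZMod 2) from congrArg Subtype.val hc.symm]
        rw [hj] at hmem
        exact (U j).smul_mem c (hVU j hmem)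
  exact (iInf₂_le _ hcov).trans (Nat.cast_le.mpr (Finset.card_image_le.trans (Finset.card_fin m).le))

/-- The `2 ^ s - 1` nonzero vectors are covered by blocks with `2 ^ t - 1` nonzero vectors each. -/
theorem ceilRatio_le_coveringNumber {s t : ℕ} (ht : 0 < t) :
    (ceilRatio t s : ℕ∞) ≤ coveringNumber (ZMod 2) s t 1 := by
  classical
  refine le_iInf₂ fun C ⟨hC, hcov⟩ => ?_
  rw [Nat.cast_le, ceilRatio, Nat.ceil_le, div_le_iff₀ (two_pow_sub_one_pos ht)]
  have hsub : (Finset.univ.erase (0 : Fin s → ZMod 2)) ⊆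
      C.biUnion fun W => (Finset.univ.filter (· ∈ W)).erase 0 := by
    intro v hv
    have hv0 := Finset.ne_of_mem_erase hv
    obtain ⟨W, hW, hvW⟩ := hcov (Submodule.span (ZMod 2) {v}) (finrank_span_singleton hv0)
    rw [Finset.mem_biUnion]
    exact ⟨W, hW, by simp [hv0, hvW (Submodule.mem_span_singleton_self v)]⟩
  have hcard := (Finset.card_le_card hsub).trans (Finset.card_biUnion_le_card_mul C _ (2 ^ t - 1)
    fun W hW => ?_)
  · rw [Finset.card_erase_of_mem (Finset.mem_univ _), Finset.card_univ] at hcard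
    simp only [Fintype.card_fun, ZMod.card, Fintype.card_fin] at hcard
    have := Nat.cast_le (α := ℚ).mpr hcard
    rw [Nat.cast_mul, Nat.cast_sub Nat.one_le_two_pow, Nat.cast_sub Nat.one_le_two_pow] at this
    simpa using this
  · rw [Finset.card_erase_of_mem (by simp), ← Fintype.card_subtype, ← Nat.card_eq_fintype_card]
    have := Module.natCard_eq_pow_finrank (K := ZMod 2) (V := W)
    rw [show finrank (ZMod 2) W = t from hC W hW, Nat.card_eq_fintype_card (α := ZMod 2),
      ZMod.card] at this
    exact (congrArg (· - 1) this).le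

/-- Split the space into `r` summands of dimension `s / r` and cover each one; `v` is the sum of its
`r` components, each found in one bucket. -/
theorem D_le_mul_ceilRatio {s t r : ℕ} (hs : 0 < s) (ht : 0 < t) (hrs : r ∣ s) :
    D s 1 t r ≤ ((r * ceilRatio t (s / r) : ℕ) : ℕ∞) := by
  classical
  obtain ⟨d, rfl⟩ := hrs
  have hr : 0 < r := Nat.pos_of_mul_pos_right hs
  have hd : 0 < d := Nat.pos_of_mul_pos_left hs
  rw [Nat.mul_div_cancel_left d hr]
  obtain ⟨C, hC, hCdim, hCv⟩ := exists_covering ht d hd (V := Fin d → ZMod 2) (by simp)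
  refine (D_le_of_submodules (V := Fin r → Fin d → ZMod 2)
    (by rw [finrank_pi_fintype]; simp)
    (fun p : Fin r × C => (p.2 : Submodule _ _).map
      (LinearMap.single (ZMod 2) (fun _ : Fin r => Fin d → ZMod 2) p.1))
    (fun p => (Submodule.finrank_map_le _ _).trans (hCdim p.2 p.2.2)) fun v _ => ?_).trans ?_
  · choose W hW hvW using fun i => hCv (v i)
    refine ⟨fun _ => Finset.univ.image fun i => (i, ⟨W i, hW i⟩),
      fun i j hij => absurd (Subsingleton.elim i j) hij,
      fun _ => ⟨Finset.card_image_le.trans (by simp), ?_⟩⟩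
    rw [← Finset.univ_sum_single v]
    refine Submodule.sum_mem _ fun i _ => ?_
    exact Finset.le_sup (f := fun p : Fin r × C => (p.2 : Submodule _ _).map
      (LinearMap.single (ZMod 2) (fun _ : Fin r => Fin d → ZMod 2) p.1))
      (Finset.mem_image_of_mem _ (Finset.mem_univ i)) (Submodule.mem_map_of_mem (hvW i))
  · rw [Nat.cast_le, Fintype.card_prod, Fintype.card_fin, Fintype.card_coe]
    exact Nat.mul_le_mul_left r hC

/-! ### Fold partitions and covering Grassmannian codes -/

theorem D_one_le_of_le_card {s k t : ℕ} {V ι : Type} [AddCommGroup V] [Module (ZMod 2) V]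
    [Module.Finite (ZMod 2) V] (hV : finrank (ZMod 2) V = s) [Fintype ι]
    (W : ι → Submodule (ZMod 2) V) (hW : ∀ i, finrank (ZMod 2) (W i) ≤ t)
    (h : ∀ v : V, v ≠ 0 → k ≤ Nat.card {i // v ∈ W i}) :
    D s k t 1 ≤ Fintype.card ι := by
  refine D_le_of_submodules_of_card_le hV W hW fun v hv =>
    ⟨{i // v ∈ W i}, inferInstance, fun i => {i.1}, h v hv, fun i j hij => ?_,
      fun i => ⟨by simp, by simpa using i.2⟩⟩
  exact Finset.disjoint_singleton.mpr fun he => hij (Subtype.ext he)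

theorem D_one_le_foldPartitionNumber (s k t : ℕ) :
    D s k t 1 ≤ foldPartitionNumber (ZMod 2) s t k := by
  classical
  refine le_iInf₂ fun P ⟨hP, hdim⟩ => ?_
  rw [← Multiset.card_coe P]
  refine D_one_le_of_le_card (V := Fin s → ZMod 2) (by simp) (fun i : P => i.1)
    (fun i => hdim _ Multiset.coe_mem) fun v hv => ?_
  have h := hP v hv
  conv_lhs at h => rw [← Multiset.map_univ_coe P]
  rw [Multiset.countP_map] at h
  rw [← h, Nat.card_eq_fintype_card, Fintype.card_subtype]
  exact le_of_eq (by congr!)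

theorem D_le_grassmannianCodeNumber {s t r : ℕ} (hr : 0 < r) (hts : t ≤ s) :
    D s (grassmannianCodeNumber (ZMod 2) s t (s - t) r / r) t r ≤
      (grassmannianCodeNumber (ZMod 2) s t (s - t) r : ℕ∞) := by
  obtain ⟨C, ⟨hdim, hspan⟩, hC⟩ := exists_card_eq_grassmannianCodeNumber (ZMod 2) s t (s - t) r hr
  rw [← hC, ← Fintype.card_coe C]
  -- Disjoint groups of `r` codewords; each group spans the whole space, so it recovers every `v`.
  let φ : Fin (Fintype.card C / r) × Fin r ↪ C :=
    (finProdFinEquiv.toEmbedding.trans (Fin.castLEEmb (Nat.div_mul_le_self _ _))).trans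
      (Fintype.equivFin C).symm.toEmbedding
  refine D_le_of_submodules (V := Fin s → ZMod 2) (by simp) (fun W : C => (W : Submodule _ _))
    (fun W => (hdim W W.2).le) fun v _ => ⟨fun i => Finset.univ.map
      ⟨fun j => φ (i, j), fun j j' h => (Prod.ext_iff.mp (φ.injective h)).2⟩,
      fun i i' hii' => Finset.disjoint_left.mpr ?_, fun i => ⟨by simp, ?_⟩⟩
  · intro W hW hW'
    obtain ⟨j, -, rfl⟩ := Finset.mem_map.mp hW
    obtain ⟨j', -, h⟩ := Finset.mem_map.mp hW'
    exact hii' (Prod.ext_iff.mp (φ.injective h)).1.symm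
  · set S := Finset.univ.map
      ⟨fun j => φ (i, j), fun j j' h => (Prod.ext_iff.mp (φ.injective h)).2⟩ with hS
    have h := hspan (S.map (Function.Embedding.subtype _)) (by
      intro W hW
      obtain ⟨W, -, rfl⟩ := Finset.mem_map.mp hW
      exact W.2) (by simp [hS])
    rw [Nat.sub_add_cancel hts, Finset.sup_map] at h
    have htop : S.sup (fun W : C => (W : Submodule (ZMod 2) (Fin s → ZMod 2))) = ⊤ :=
      Submodule.eq_top_of_finrank_eq
        (le_antisymm (Submodule.finrank_le _) (by rw [finrank_fin_fun]; exact h))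
    rw [htop]
    trivial

/-! ### Counting subspaces -/

section SubspaceCount

variable {F : Type*} [Field F]

theorem finrank_comap_mkQ {V : Type*} [AddCommGroup V] [Module F V] [Module.Finite F V]
    (L : Submodule F V) (U : Submodule F (V ⧸ L)) :
    finrank F (U.comap L.mkQ) = finrank F U + finrank F L := by
  have h := (L.mkQ.domRestrict (U.comap L.mkQ)).finrank_range_add_finrank_ker
  rw [LinearMap.range_domRestrict, Submodule.map_comap_eq_of_surjective L.mkQ_surjective,
    LinearMap.ker_domRestrict, Submodule.ker_mkQ] at h
  rw [← h]
  congr 1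
  have hle : L ≤ U.comap L.mkQ := by
    intro x hx
    rw [Submodule.mem_comap, Submodule.mkQ_apply, (Submodule.Quotient.mk_eq_zero L).mpr hx]
    exact U.zero_mem
  exact (Submodule.comapSubtypeEquivOfLe hle).finrank_eq

theorem card_submodules_containing {V : Type*} [AddCommGroup V] [Module F V] [Module.Finite F V]
    {v : V} (hv : v ≠ 0) (t : ℕ) :
    Nat.card {W : {W : Submodule F V // finrank F W = t + 1} // v ∈ W.1} =
      Nat.card {U : Submodule F (V ⧸ Submodule.span F {v}) // finrank F U = t} := by
  set L := Submodule.span F {v}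
  have hmem : ∀ U : Submodule F (V ⧸ L), v ∈ U.comap L.mkQ := fun U => by
    rw [Submodule.mem_comap, Submodule.mkQ_apply,
      (Submodule.Quotient.mk_eq_zero L).mpr (Submodule.mem_span_singleton_self v)]
    exact U.zero_mem
  have hdim : ∀ U : {U : Submodule F (V ⧸ L) // finrank F U = t},
      finrank F (U.1.comap L.mkQ) = t + 1 := fun U => by
    rw [finrank_comap_mkQ, U.2, finrank_span_singleton hv]
  refine (Nat.card_congr (Equiv.ofBijective
    (fun U => ⟨⟨U.1.comap L.mkQ, hdim U⟩, hmem U.1⟩) ⟨?_, ?_⟩)).symm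
  · intro U U' h
    simp only [Subtype.mk.injEq] at h
    exact Subtype.ext (Submodule.comap_injective_of_surjective L.mkQ_surjective h)
  · rintro ⟨⟨W, hW⟩, hvW⟩
    have hc : (W.map L.mkQ).comap L.mkQ = W := by
      rw [Submodule.comap_map_mkQ]
      exact sup_eq_right.mpr ((Submodule.span_singleton_le_iff_mem v W).mpr hvW)
    refine ⟨⟨W.map L.mkQ, ?_⟩, Subtype.ext (Subtype.ext hc)⟩
    have h := finrank_comap_mkQ L (W.map L.mkQ)
    rw [hc, hW, finrank_span_singleton hv] at h
    omega

/-- Induction on `t` by double counting pairs `0 ≠ v ∈ W`: the subspaces through `v` correspond to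
those of the quotient by `v`, one dimension lower. The product form avoids division and remains
valid for `t > n`, where both sides vanish. -/
theorem card_submodules_mul_prod [Finite F] (t : ℕ) {V : Type*} [AddCommGroup V] [Module F V]
    [Module.Finite F V] {n : ℕ} (hV : finrank F V = n) :
    Nat.card {W : Submodule F V // finrank F W = t} *
      ∏ i ∈ Finset.range t, (Nat.card F ^ (t - i) - 1) =
      ∏ i ∈ Finset.range t, (Nat.card F ^ (n - i) - 1) := by
  classical
  induction t generalizing V n with
  | zero =>
    have : Unique {W : Submodule F V // finrank F W = 0} :=
      { default := ⟨⊥, finrank_bot F V⟩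
        uniq := fun W => Subtype.ext (Submodule.finrank_eq_zero.mp W.2) }
    simp
  | succ t ih =>
    have : Finite V := Module.finite_of_finite F
    have := Fintype.ofFinite V
    have := Fintype.ofFinite {W : Submodule F V // finrank F W = t + 1}
    have hcount : Nat.card {W : Submodule F V // finrank F W = t + 1} *
        (Nat.card F ^ (t + 1) - 1) * ∏ i ∈ Finset.range t, (Nat.card F ^ (t - i) - 1) =
        (Nat.card F ^ n - 1) * ∏ i ∈ Finset.range t, (Nat.card F ^ (n - 1 - i) - 1) := by
      have hdouble := Finset.sum_card_bipartiteAbove_eq_sum_card_bipartiteBelow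
        (s := (Finset.univ : Finset {W : Submodule F V // finrank F W = t + 1}))
        (t := (Finset.univ.erase (0 : V))) (fun W v => v ∈ W.1)
      rw [Finset.sum_congr rfl (g := fun _ => Nat.card F ^ (t + 1) - 1)] at hdouble
      · rw [Finset.sum_const, Finset.card_univ, smul_eq_mul, ← Nat.card_eq_fintype_card]
          at hdouble
        rw [hdouble, Finset.sum_mul, Finset.sum_congr rfl
          (g := fun _ => ∏ i ∈ Finset.range t, (Nat.card F ^ (n - 1 - i) - 1))]
        · rw [Finset.sum_const, Finset.card_erase_of_mem (Finset.mem_univ _), Finset.card_univ,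
            ← Nat.card_eq_fintype_card, Module.natCard_eq_pow_finrank (K := F), hV, smul_eq_mul]
        · intro v hv
          have hv0 := Finset.ne_of_mem_erase hv
          have hq := (Submodule.span F {v}).finrank_quotient_add_finrank
          rw [finrank_span_singleton hv0, hV] at hq
          rw [← ih (V := V ⧸ Submodule.span F {v}) (n := n - 1) (by omega),
            ← card_submodules_containing hv0, Nat.card_eq_fintype_card (α := Subtype _),
            Fintype.card_subtype]
          rfl
      · intro W _
        have hW := Module.natCard_eq_pow_finrank (K := F) (V := W.1)
        rw [W.2] at hW
        rw [← hW, Nat.card_eq_fintype_card, Fintype.card_subtype,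
          ← Finset.card_erase_of_mem (a := (0 : V)) (by simp)]
        congr 1
        ext v
        simp [Finset.mem_bipartiteAbove]
    rw [Finset.prod_range_succ', Finset.prod_range_succ']
    simp only [Nat.add_sub_add_right, Nat.sub_zero]
    rw [mul_comm (∏ i ∈ Finset.range t, _) (Nat.card F ^ (t + 1) - 1), ← mul_assoc, hcount,
      mul_comm]
    simp only [Nat.sub_sub, add_comm 1]

theorem card_submodules_eq_gaussianCoeff [Finite F] (t : ℕ) {V : Type*} [AddCommGroup V]
    [Module F V] [Module.Finite F V] {n : ℕ} (hV : finrank F V = n) :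
    Nat.card {W : Submodule F V // finrank F W = t} = gaussianCoeff (Nat.card F) n t := by
  rw [gaussianCoeff, ← card_submodules_mul_prod t hV, Nat.mul_div_cancel]
  refine Finset.prod_pos fun i hi => Nat.sub_pos_of_lt ?_
  exact Nat.one_lt_pow (Nat.sub_ne_zero_of_lt (Finset.mem_range.mp hi)) Finite.one_lt_card

end SubspaceCount

theorem D_le_gaussianCoeff {s t : ℕ} (ht : 0 < t) :
    D s (gaussianCoeff 2 (s - 1) (t - 1)) t 1 ≤ (gaussianCoeff 2 s t : ℕ∞) := by
  obtain ⟨t, rfl⟩ := Nat.exists_eq_add_of_le' ht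
  have := Fintype.ofFinite {W : Submodule (ZMod 2) (Fin s → ZMod 2) // finrank (ZMod 2) W = t + 1}
  have hcard := card_submodules_eq_gaussianCoeff (F := ZMod 2) (t + 1) (V := Fin s → ZMod 2)
    (n := s) (by simp)
  rw [Nat.card_zmod, Nat.card_eq_fintype_card] at hcard
  rw [← hcard]
  refine D_one_le_of_le_card (V := Fin s → ZMod 2) (by simp) (fun W => W.1) (fun W => W.2.le)
    fun v hv => ?_
  have hq := (Submodule.span (ZMod 2) {v}).finrank_quotient_add_finrank
  rw [finrank_span_singleton hv, finrank_fin_fun] at hq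
  rw [card_submodules_containing hv t, card_submodules_eq_gaussianCoeff t (n := s - 1) (by omega),
    Nat.card_zmod, Nat.add_sub_cancel]

/-! ### The Desarguesian spread -/

section Spread

variable {K : Type} [Field K] {V : Type} [AddCommGroup V] [Module K V]

open scoped LinearAlgebra.Projectivization

/-- Besides the point of `v`, the lines through `v` carry the points `⟨u + a • v⟩` with `u` from
a system of representatives modulo `v`. -/
theorem exists_points_on_lines (v : V) :
    ∃ (u : ℙ K (V ⧸ Submodule.span K {v}) → V) (h : ∀ z (a : K), u z + a • v ≠ 0),
      (∀ z z' a a', Projectivization.mk K (u z + a • v) (h z a) =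
        Projectivization.mk K (u z' + a' • v) (h z' a') → z = z' ∧ (v ≠ 0 → a = a')) ∧
      ∀ (hv : v ≠ 0) z a, Projectivization.mk K v hv ≠
        Projectivization.mk K (u z + a • v) (h z a) := by
  set L := Submodule.span K {v}
  choose u hu using fun z : ℙ K (V ⧸ L) => L.mkQ_surjective z.rep
  have hv0 : L.mkQ v = 0 :=
    (Submodule.Quotient.mk_eq_zero L).mpr (Submodule.mem_span_singleton_self v)
  have hmk : ∀ z (a : K), L.mkQ (u z + a • v) = z.rep := fun z a => by
    rw [map_add, map_smul, hv0, smul_zero, add_zero, hu]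
  refine ⟨u, fun z a h => z.rep_nonzero (by rw [← hmk z a, h, map_zero]), ?_, ?_⟩
  · intro z z' a a' h
    obtain ⟨c, hc⟩ := (Projectivization.mk_eq_mk_iff' ..).mp h
    have hc' := congrArg L.mkQ hc
    rw [map_smul, hmk, hmk] at hc'
    have hz : z = z' := by
      rw [← z.mk_rep, ← z'.mk_rep]
      exact (Projectivization.mk_eq_mk_iff' ..).mpr ⟨c, hc'⟩
    subst hz
    refine ⟨rfl, fun hv => ?_⟩
    -- Both vectors reduce to `z.rep` modulo `v`, which forces the scalar to be 1.
    have hc1 : c = 1 := by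
      refine smul_left_injective K z.rep_nonzero ?_
      simpa using hc'
    rw [hc1, one_smul] at hc
    exact (smul_left_injective K hv (add_left_cancel hc)).symm
  · intro hv z a h
    obtain ⟨c, hc⟩ := (Projectivization.mk_eq_mk_iff' ..).mp h
    have hc' := congrArg L.mkQ hc
    rw [map_smul, hmk, hv0, smul_eq_zero] at hc'
    obtain rfl | h0 := hc'
    · rw [zero_smul] at hc
      exact hv hc.symm
    · exact z.rep_nonzero h0

variable [Algebra (ZMod 2) K] [Module (ZMod 2) V] [IsScalarTower (ZMod 2) K V]

/-- The points of the projective space of `V` form a spread of the space `V` over the prime field: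
each nonzero vector is recovered by the point on it, and by pairs of points on the lines
through it. -/
theorem D_le_card_projectivization [Finite K] [Module.Finite K V] {s t r k : ℕ}
    (hK : finrank (ZMod 2) K = t) (hr : 0 < r) (hV : finrank K V = r) (hs : s = r * t)
    (hk : ∀ p, p * (2 ^ t - 1) + 1 = 2 ^ ((r - 1) * t) → k ≤ p * 2 ^ (t - 1) + 1) :
    D s k t r ≤ (Nat.card (ℙ K V) : ℕ∞) := by
  classical
  have : Module.Finite (ZMod 2) K := Module.Finite.of_finite
  have : Module.Finite (ZMod 2) V := Module.Finite.trans K V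
  have : Finite V := Module.finite_of_finite K
  have := Fintype.ofFinite (ℙ K V)
  have hKc : Nat.card K = 2 ^ t := by
    rw [Module.natCard_eq_pow_finrank (K := ZMod 2), hK, Nat.card_zmod]
  rw [Nat.card_eq_fintype_card]
  refine D_le_of_submodules_of_card_le (V := V)
    (by rw [← finrank_mul_finrank (ZMod 2) K V, hK, hV, hs, mul_comm])
    (fun x : ℙ K V => x.submodule.restrictScalars (ZMod 2)) (fun x => ?_) fun v hv => ?_
  · have h := finrank_mul_finrank (ZMod 2) K x.submodule
    rw [x.finrank_submodule, hK, mul_one] at h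
    exact h.ge
  · obtain ⟨u, hu0, huinj, huv⟩ := exists_points_on_lines (K := K) v
    -- As `f 1 = 1`, the hyperplane `ker f` contains exactly one element of each pair `{a, a + 1}`
    -- in `K`, so it indexes the pairs.
    obtain ⟨f, hf⟩ := (Algebra.linearMap (ZMod 2) K).exists_leftInverse_of_injective
      (LinearMap.ker_eq_bot.mpr (algebraMap (ZMod 2) K).injective)
    have hf1 : f 1 = 1 := by simpa using LinearMap.congr_fun hf 1
    have hfs : LinearMap.range f = ⊤ :=
      LinearMap.range_eq_top.mpr fun b => ⟨algebraMap _ _ b, LinearMap.congr_fun hf b⟩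
    have hrank := f.finrank_range_add_finrank_ker
    rw [hfs, finrank_top, finrank_self, hK] at hrank
    have hH : Nat.card (LinearMap.ker f) = 2 ^ (t - 1) := by
      rw [Module.natCard_eq_pow_finrank (K := ZMod 2), Nat.card_zmod, ← hrank,
        Nat.add_sub_cancel_left]
    set Q := V ⧸ Submodule.span K {v}
    have hQ : finrank K Q + 1 = r := by
      rw [← hV, ← (Submodule.span K {v}).finrank_quotient_add_finrank, finrank_span_singleton hv]
    let pt : ℙ K Q → K → ℙ K V := fun z a => Projectivization.mk K (u z + a • v) (hu0 z a)
    let S : Option (ℙ K Q × LinearMap.ker f) → Finset (ℙ K V) := fun o =>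
      o.elim {Projectivization.mk K v hv} fun p => {pt p.1 p.2, pt p.1 (p.2 + 1)}
    have hS : ∀ p x, x ∈ S (some p) → ∃ a, x = pt p.1 a ∧ (a = p.2 ∨ a = p.2 + 1) := by
      intro p x hx
      rcases Finset.mem_insert.mp hx with h | h
      · exact ⟨_, h, Or.inl rfl⟩
      · exact ⟨_, Finset.mem_singleton.mp h, Or.inr rfl⟩
    have hnone : ∀ p, Disjoint (S none) (S (some p)) := by
      refine fun p => Finset.disjoint_left.mpr fun x hx hx' => ?_
      obtain ⟨a, rfl, -⟩ := hS p x hx'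
      exact huv hv _ _ (Finset.mem_singleton.mp hx).symm
    have : Finite Q := Quotient.finite _
    have : Finite (ℙ K Q) := (Projectivization.finite_iff_of_finite K Q).mpr this
    refine ⟨Option (ℙ K Q × LinearMap.ker f), inferInstance, S, ?_, ?_, ?_⟩
    · rw [Finite.card_option, Nat.card_prod, hH]
      -- Here `p` is the number of lines through the point of `v`; each contributes `2 ^ (t - 1)`
      -- pairs.
      refine hk _ ?_
      have h := Projectivization.card' K Q
      rw [Module.natCard_eq_pow_finrank (K := K), hKc, ← pow_mul, mul_comm t] at h
      rw [← h, ← hQ, Nat.add_sub_cancel]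
    · rintro (_ | p) (_ | p') hpp'
      · exact absurd rfl hpp'
      · exact hnone p'
      · exact (hnone p).symm
      · refine Finset.disjoint_left.mpr fun x hx hx' => hpp' ?_
        obtain ⟨a, rfl, ha⟩ := hS p x hx
        obtain ⟨a', h, ha'⟩ := hS p' _ hx'
        obtain ⟨hz, hva⟩ := huinj _ _ _ _ h
        have haa := hva hv
        refine congrArg some (Prod.ext hz (Subtype.ext ?_))
        have h0 : f p.2 = 0 := p.2.2
        have h0' : f p'.2 = 0 := p'.2.2
        rcases ha with rfl | rfl <;> rcases ha' with rfl | rfl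
        · exact haa
        · have := congrArg f haa
          rw [map_add, h0, h0', hf1] at this
          exact absurd this (by decide)
        · have := congrArg f haa
          rw [map_add, h0, h0', hf1] at this
          exact absurd this (by decide)
        · exact add_right_cancel haa
    · rintro (_ | p)
      · refine ⟨(Finset.card_singleton _).trans_le hr, ?_⟩
        simp only [S, Option.elim_none, Finset.sup_singleton, Projectivization.submodule_mk]
        exact Submodule.mem_span_singleton_self v
      · constructor
        -- A pair exists only if the quotient is nonzero, that is `r ≥ 2`, so two columns are
        -- allowed.
        · have : 0 < finrank K Q := finrank_pos_iff_exists_ne_zero.mpr ⟨_, p.1.rep_nonzero⟩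
          exact Finset.card_le_two.trans (by omega)
        · have hpt : ∀ a, u p.1 + a • v ∈ (pt p.1 a).submodule := fun a => by
            rw [Projectivization.submodule_mk]
            exact Submodule.mem_span_singleton_self _
          have hv2 : v = (u p.1 + ((p.2 : K) + 1) • v) - (u p.1 + (p.2 : K) • v) := by
            rw [add_smul, one_smul]
            abel
          refine (congrArg (· ∈ (S (some p)).sup _) hv2).mpr ?_
          simp only [S, Option.elim_some, Finset.sup_insert, Finset.sup_singleton]
          exact sub_mem (Submodule.mem_sup_right (hpt _)) (Submodule.mem_sup_left (hpt _))

end Spread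

/-- The quotient equals `p * 2 ^ t / r`, which is at most `p * 2 ^ (t - 1)` once `r ≥ 2`; for `r =
1` the hypothesis forces `p = 0`. -/
theorem floor_add_one_le {r t p : ℕ} (hr : 0 < r) (ht : 0 < t)
    (hp : p * (2 ^ t - 1) + 1 = 2 ^ ((r - 1) * t)) :
    ⌊((2 : ℚ) ^ (r * t) - 2 ^ t) / ((r : ℚ) * 2 ^ t - r)⌋₊ + 1 ≤ p * 2 ^ (t - 1) + 1 := by
  have hq := two_pow_sub_one_pos ht
  have hpq : (p : ℚ) * (2 ^ t - 1) + 1 = 2 ^ ((r - 1) * t) := by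
    have := congrArg (Nat.cast (R := ℚ)) hp
    rw [Nat.cast_add, Nat.cast_mul, Nat.cast_sub Nat.one_le_two_pow] at this
    simpa using this
  have hr' : (0 : ℚ) < r := Nat.cast_pos.mpr hr
  obtain ⟨r, rfl⟩ : ∃ r', r = r' + 1 := ⟨r - 1, by omega⟩
  obtain ⟨t, rfl⟩ : ∃ t', t = t' + 1 := ⟨t - 1, by omega⟩
  rw [Nat.add_sub_cancel] at hp hpq
  refine Nat.add_le_add_right (Nat.floor_le_of_le ?_) 1
  rw [div_le_iff₀ (by rw [← mul_sub_one]; exact mul_pos hr' hq), add_one_mul r, pow_add, ← hpq]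
  rw [Nat.add_sub_cancel]
  push_cast
  have hnum : ((p : ℚ) * (2 ^ (t + 1) - 1) + 1) * 2 ^ (t + 1) - 2 ^ (t + 1) =
      p * 2 ^ t * (2 ^ (t + 1) - 1) * 2 := by ring
  have hden : (p : ℚ) * 2 ^ t * ((r + 1) * 2 ^ (t + 1) - (r + 1)) =
      p * 2 ^ t * (2 ^ (t + 1) - 1) * (r + 1) := by ring
  rw [hnum, hden]
  rcases Nat.eq_zero_or_pos r with rfl | hr0
  · rw [zero_mul, pow_zero] at hpq
    rw [show (p : ℚ) * 2 ^ t * (2 ^ (t + 1) - 1) = p * (2 ^ (t + 1) - 1) * 2 ^ t by ring,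
      add_eq_right.mp hpq]
    simp
  · refine mul_le_mul_of_nonneg_left ?_ (mul_nonneg (by positivity) hq.le)
    have : (1 : ℚ) ≤ r := Nat.one_le_cast.mpr hr0
    linarith

theorem D_le_spread {s t r : ℕ} (ht : 0 < t) (hr : 0 < r) (hs : s = r * t) :
    D s (⌊((2 : ℚ) ^ s - 2 ^ t) / ((r : ℚ) * 2 ^ t - r)⌋₊ + 1) t r ≤
      (((2 ^ s - 1) / (2 ^ t - 1) : ℕ) : ℕ∞) := by
  have hKc : Nat.card (GaloisField 2 t) = 2 ^ t := GaloisField.card 2 t ht.ne'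
  have : Finite (GaloisField 2 t) := Nat.finite_of_card_ne_zero (by rw [hKc]; positivity)
  have h := D_le_card_projectivization (K := GaloisField 2 t) (V := Fin r → GaloisField 2 t)
    (GaloisField.finrank 2 ht.ne') hr (by simp) hs fun p => floor_add_one_le hr ht
  rw [Projectivization.card'', Nat.card_fun, hKc, Nat.card_fin, ← pow_mul, mul_comm t,
    ← hs] at h
  convert h using 5

end LocalityCode

theorem theorem29 (s k t r : ℕ) (hs : 0 < s) (hk : 0 < k) (ht : 0 < t) (hr : 0 < r)
    (hts : t ≤ s) :
    (LocalityCode.D s 1 t 1 = LocalityCode.coveringNumber (ZMod 2) s t 1 ∧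
      LocalityCode.coveringNumber (ZMod 2) s t 1 =
        ((⌈((2 : ℚ) ^ s - 1) / ((2 : ℚ) ^ t - 1)⌉₊ : ℕ) : ℕ∞)) ∧
    (r ∣ s → LocalityCode.D s 1 t r ≤
      ((r * ⌈((2 : ℚ) ^ (s / r) - 1) / ((2 : ℚ) ^ t - 1)⌉₊ : ℕ) : ℕ∞)) ∧
    LocalityCode.D s k t 1 ≤ LocalityCode.foldPartitionNumber (ZMod 2) s t k ∧
    LocalityCode.D s (LocalityCode.grassmannianCodeNumber (ZMod 2) s t (s - t) r / r) t r ≤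
      ((LocalityCode.grassmannianCodeNumber (ZMod 2) s t (s - t) r : ℕ) : ℕ∞) ∧
    (1 < t → LocalityCode.D s (LocalityCode.gaussianCoeff 2 (s - 1) (t - 1)) t 1 ≤
      ((LocalityCode.gaussianCoeff 2 s t : ℕ) : ℕ∞)) ∧
    (s = r * t →
      LocalityCode.D s (⌊((2 : ℚ) ^ s - 2 ^ t) / ((r : ℚ) * 2 ^ t - r)⌋₊ + 1) t r ≤
        (((2 ^ s - 1) / (2 ^ t - 1) : ℕ) : ℕ∞)) := by
  have hD := LocalityCode.D_le_ceilRatio hs ht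
  have hC := LocalityCode.ceilRatio_le_coveringNumber (s := s) ht
  have hCD := LocalityCode.coveringNumber_le_D hts
  exact ⟨⟨le_antisymm (hD.trans hC) hCD, le_antisymm (hCD.trans hD) hC⟩,
    LocalityCode.D_le_mul_ceilRatio hs ht, LocalityCode.D_one_le_foldPartitionNumber s k t,
    LocalityCode.D_le_grassmannianCodeNumber hr hts,
    fun _ => LocalityCode.D_le_gaussianCoeff ht, LocalityCode.D_le_spread ht hr⟩
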